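/- Let $r,T>0$ and $K=[-r,r]$. Let $f:[0,T]\times\mathbb R\to\mathbb R$ satisfy: (H1) $f(\cdot,x)$ is measurable on $[0,T]$ for every $x\in\mathbb R$, $f(t,\cdot)$ is continuous for a.e. $t\in[0,T]$, and $|f(t,x)|\le m(t)$ for all $(t,x)\in[0,T]\times\mathbb R$, where $m\in L^1([0,T])$; put $\|m\|_1=\int_0^T|m(t)|\,dt$. (H2) There is $\alpha\in L^1([0,T])$ such that, for a.e. $t\in[0,T]$, $|f(t,x)-f(t,y)|\le\alpha(t)|x-y|$ for all $x,y\in\mathbb R$. Consider the one-dimensional billiard with elastic impacts $$\ddot x(t)=f(t,x(t))\ \text{ for a.e. } t\in[0,T] \text{ with } x(t)\in(-r,r),\qquad \dot x(s+)=-\dot x(s)\ \text{ if } x(s)\in\{-r,r\}.\qquad (*)$$ A solution of $(*)$ is a continuous function $x:[0,T]\to K$ that has an absolutely continuous derivative on every compact interval on which $x(t)\in(-r,r)$, satisfies the differential equation a.e. on such intervals, and satisfies the impact law at every $s\in(0,T)$ with $|x(s)|=r$, where $\dot x(s)$ and $\dot x(s+)$ denote the left and the right derivative of $x$ at $s$ (both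 are required to exist). The impact times of $x$ are the $t\in[0,T]$ with $|x(t)|=r$. Let $v,w>\|m\|_1$, and let $x_v$ and $x_w$ be solutions of $(*)$ with $x_v(0)=x_w(0)=0$, $\dot x_v(0)=v$ and $\dot x_w(0)=w$. Suppose that $x_v$ has exactly $k$ impact times and $x_w$ has exactly $k+j$ impact times, with integers $k\ge 0$ and $j\ge 2$. Then the impulsive Dirichlet problem has a solution: there is a solution $x$ of $(*)$ with $x(0)=x(T)=0$. -/

import Mathlib

open MeasureTheory Set

/-- `f : [0,T] × ℝ → ℝ` is a Carathéodory function integrably bounded by `m ∈ L¹([0,T])`.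
Only the values of `f` and `m` at times in `[0,T]` matter; measurability is Lebesgue
measurability on `[0,T]`. -/
structure IsCaratheodoryBoundedBy (T : ℝ) (f : ℝ → ℝ → ℝ) (m : ℝ → ℝ) : Prop where
  measurable : ∀ x : ℝ, AEMeasurable (fun t => f t x) (volume.restrict (Icc 0 T))
  continuous : ∀ᵐ t ∂(volume.restrict (Icc 0 T)), Continuous (f t)
  integrable : IntegrableOn m (Icc 0 T)
  bound : ∀ t ∈ Icc 0 T, ∀ x : ℝ, |f t x| ≤ m t

/-- `f` is Lipschitz in the second variable with an integrable Lipschitz coefficient. -/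
def IsIntegrablyLipschitz (T : ℝ) (f : ℝ → ℝ → ℝ) : Prop :=
  ∃ α : ℝ → ℝ, IntegrableOn α (Icc 0 T) ∧
    ∀ᵐ t ∂(volume.restrict (Icc 0 T)), ∀ x y : ℝ, |f t x - f t y| ≤ α t * |x - y|

/-- `x : [0,T] → K = [-r,r]` is a solution of the impulsive equation `x'' = f(t,x)` in the
interior of `K`, `x'(s+) = -x'(s)` when `x(s) ∈ ∂K = {-r, r}`.

* `ode`: on every compact time interval during which `x` stays in the interior of `K`, it has an
  absolutely continuous derivative `u`, whose derivative is `f (t, x t)` for almost every `t`.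
* `impact`: the velocity `p` before the impact is the left derivative of `x` at `s`, the velocity
  after it is the right derivative, and the elastic impact law says that the latter is `-p`.
  (There is no time after `T`, so the law is void at `s = T`.) -/
structure IsBilliardSolution (r T : ℝ) (f : ℝ → ℝ → ℝ) (x : ℝ → ℝ) : Prop where
  continuousOn : ContinuousOn x (Icc 0 T)
  mem_table : ∀ t ∈ Icc 0 T, x t ∈ Icc (-r) r
  ode : ∀ a b : ℝ, 0 ≤ a → a < b → b ≤ T → (∀ t ∈ Icc a b, x t ∈ Ioo (-r) r) →
    ∃ u : ℝ → ℝ, AbsolutelyContinuousOnInterval u a b ∧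
      (∀ t ∈ Icc a b, HasDerivWithinAt x (u t) (Icc a b) t) ∧
      (∀ᵐ t ∂(volume.restrict (Icc a b)), HasDerivAt u (f t (x t)) t)
  impact : ∀ s ∈ Ioo 0 T, (x s = -r ∨ x s = r) →
    ∃ p : ℝ, HasDerivWithinAt x p (Iic s) s ∧ HasDerivWithinAt x (-p) (Ici s) s

/-- Solutions of the impulsive Cauchy problem `x(0) = 0`, `x'(0) = v`. -/
def IsCauchySolution (r T : ℝ) (f : ℝ → ℝ → ℝ) (v : ℝ) (x : ℝ → ℝ) : Prop :=
  IsBilliardSolution r T f x ∧ x 0 = 0 ∧ HasDerivWithinAt x v (Ici 0) 0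

/-- Solutions of the impulsive Dirichlet problem `x(0) = x(T) = 0`. -/
def IsDirichletSolution (r T : ℝ) (f : ℝ → ℝ → ℝ) (x : ℝ → ℝ) : Prop :=
  IsBilliardSolution r T f x ∧ x 0 = 0 ∧ x T = 0

/-- The times in `[0,T]` at which `x` is on the boundary of the table `[-r,r]`. -/
def impactTimes (r T : ℝ) (x : ℝ → ℝ) : Set ℝ :=
  {t | t ∈ Icc 0 T ∧ (x t = -r ∨ x t = r)}

open Filter Topology

/-! Reflect the table instead of the particle: a billiard motion is the fold `tent` of a motion `Y`
on the whole line, where impacts become passages through the walls at odd multiples of `r`. The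
unfolded force is `tentSign * F`, discontinuous at the walls. Since the initial velocity exceeds the
total impulse available, `Y` is strictly increasing and meets the walls at only countably many
times, so the discontinuities do no harm. The number of impacts locates the final position: `n`
impacts mean `(2n-1)r ≤ Y T < (2n+1)r`. Hence the `v`-motion ends below `(2k+1)r` and the `w`-motion
at or beyond `(2k+3)r`, and between them lies `2r(k+1)`, which folds to `0`. It remains to see that
`Y T` depends continuously on the initial velocity. Compactness (`exists_subseq_tendsto`) yields
existence, through delayed equations, and subsequential limits. Uniqueness (`eqOn_tent`) is proved
for the folded motion, where the force is Lipschitz between impacts; it fixes `Y T`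
(`final_pos_unique`) and turns compactness into continuity (`exists_final_pos_eq`). -/

/-! ### Folding map and cells. -/

/-- The folding map `ℝ → [-r, r]` of the table `[-r, r]`: the triangle wave of slope `±1`. -/
noncomputable def tent (r y : ℝ) : ℝ :=
  2 * r / Real.pi * Real.arcsin (Real.sin (Real.pi * y / (2 * r)))

/-- The slope `±1` of the folding map. -/
noncomputable def tentSign (r y : ℝ) : ℝ :=
  -- The value `-1` at the walls is arbitrary; increasing motions are there only at countably many
  -- times.
  if 0 < Real.cos (Real.pi * y / (2 * r)) then 1 else -1

lemma neg_one_zpow_cases (i : ℤ) : (-1 : ℝ) ^ i = 1 ∨ (-1 : ℝ) ^ i = -1 := by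
  rcases Int.even_or_odd i with h | h
  · exact Or.inl h.neg_one_zpow
  · exact Or.inr h.neg_one_zpow

lemma tentSign_cases (r y : ℝ) : tentSign r y = 1 ∨ tentSign r y = -1 := by
  unfold tentSign; split_ifs <;> simp

lemma abs_tentSign (r y : ℝ) : |tentSign r y| = 1 := by
  rcases tentSign_cases r y with h | h <;> simp [h]

lemma measurable_tentSign (r : ℝ) : Measurable (tentSign r) := by
  refine Measurable.ite ?_ measurable_const measurable_const
  exact (isOpen_lt continuous_const (by fun_prop)).measurableSet

lemma continuous_tent (r : ℝ) : Continuous (tent r) := by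
  unfold tent
  exact continuous_const.mul (Real.continuous_arcsin.comp (by fun_prop))

lemma tent_cell {r : ℝ} (hr : 0 < r) (i : ℤ) {z : ℝ} (h1 : -r ≤ z) (h2 : z ≤ r) :
    tent r (2 * r * i + z) = (-1) ^ i * z := by
  have hpi := Real.pi_pos
  have e : Real.pi * (2 * r * i + z) / (2 * r) = Real.pi * z / (2 * r) + i * Real.pi := by
    field_simp; ring
  have b1 : -(Real.pi / 2) ≤ Real.pi * z / (2 * r) := by
    rw [le_div_iff₀ (by positivity)]; nlinarith
  have b2 : Real.pi * z / (2 * r) ≤ Real.pi / 2 := by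
    rw [div_le_iff₀ (by positivity)]; nlinarith
  have key : Real.arcsin ((-1) ^ i * Real.sin (Real.pi * z / (2 * r)))
      = (-1) ^ i * (Real.pi * z / (2 * r)) := by
    rcases neg_one_zpow_cases i with h | h <;> rw [h]
    · rw [one_mul, one_mul, Real.arcsin_sin b1 b2]
    · rw [neg_one_mul, neg_one_mul, Real.arcsin_neg, Real.arcsin_sin b1 b2]
  rw [tent, e, Real.sin_add_int_mul_pi, key]
  field_simp

lemma tentSign_cell {r : ℝ} (hr : 0 < r) (i : ℤ) {z : ℝ} (h1 : -r < z) (h2 : z < r) :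
    tentSign r (2 * r * i + z) = (-1) ^ i := by
  have hpi := Real.pi_pos
  have e : Real.pi * (2 * r * i + z) / (2 * r) = Real.pi * z / (2 * r) + i * Real.pi := by
    field_simp; ring
  have b1 : -(Real.pi / 2) < Real.pi * z / (2 * r) := by
    rw [lt_div_iff₀ (by positivity)]; nlinarith
  have b2 : Real.pi * z / (2 * r) < Real.pi / 2 := by
    rw [div_lt_iff₀ (by positivity)]; nlinarith
  have hc : 0 < Real.cos (Real.pi * z / (2 * r)) := Real.cos_pos_of_mem_Ioo ⟨b1, b2⟩
  rw [tentSign, e, Real.cos_add_int_mul_pi]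
  rcases neg_one_zpow_cases i with h | h <;> rw [h]
  · simp [hc]
  · rw [if_neg (by linarith)]

/-- A wall is assigned to the cell on its right, the one an increasing motion is about to enter. -/
lemma exists_cell {r : ℝ} (hr : 0 < r) (y : ℝ) :
    ∃ i : ℤ, 2 * r * i - r ≤ y ∧ y < 2 * r * i + r := by
  refine ⟨⌊(y + r) / (2 * r)⌋, ?_, ?_⟩
  · have := Int.floor_le ((y + r) / (2 * r))
    rw [le_div_iff₀ (by positivity)] at this
    linarith
  · have := Int.lt_floor_add_one ((y + r) / (2 * r))
    rw [div_lt_iff₀ (by positivity)] at this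
    linarith

lemma tent_of_mem_cell {r : ℝ} (hr : 0 < r) (i : ℤ) {y : ℝ} (h1 : 2 * r * i - r ≤ y)
    (h2 : y ≤ 2 * r * i + r) : tent r y = (-1) ^ i * (y - 2 * r * i) := by
  have := tent_cell hr i (z := y - 2 * r * i) (by linarith) (by linarith)
  rwa [add_sub_cancel] at this

lemma tentSign_of_mem_cell {r : ℝ} (hr : 0 < r) (i : ℤ) {y : ℝ} (h1 : 2 * r * i - r < y)
    (h2 : y < 2 * r * i + r) : tentSign r y = (-1) ^ i := by
  have := tentSign_cell hr i (z := y - 2 * r * i) (by linarith) (by linarith)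
  rwa [add_sub_cancel] at this

lemma tent_mem {r : ℝ} (hr : 0 < r) (y : ℝ) : tent r y ∈ Icc (-r) r := by
  obtain ⟨i, h1, h2⟩ := exists_cell hr y
  rw [tent_of_mem_cell hr i h1 h2.le]
  rcases neg_one_zpow_cases i with h | h <;> rw [h] <;> constructor <;> linarith

lemma tent_zero (r : ℝ) : tent r 0 = 0 := by simp [tent]

/-- The folding map takes the values `±r` exactly at the cell walls, the odd multiples of `r`. -/
lemma tent_eq_wall_iff {r : ℝ} (hr : 0 < r) (y : ℝ) :
    (tent r y = -r ∨ tent r y = r) ↔ ∃ i : ℤ, y = 2 * r * i - r := by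
  obtain ⟨j, h1, h2⟩ := exists_cell hr y
  constructor
  · intro h
    rw [tent_of_mem_cell hr j h1 h2.le] at h
    refine ⟨j, ?_⟩
    rcases neg_one_zpow_cases j with hj | hj <;> rw [hj] at h <;> rcases h with h | h <;> linarith
  · rintro ⟨i, rfl⟩
    rw [tent_of_mem_cell hr i le_rfl (by linarith)]
    rcases neg_one_zpow_cases i with hj | hj <;> rw [hj]
    · left; ring
    · right; ring

lemma continuousAt_tentSign {r : ℝ} (hr : 0 < r) {y : ℝ} (hy : ∀ i : ℤ, y ≠ 2 * r * i - r) :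
    ContinuousAt (tentSign r) y := by
  obtain ⟨j, h1, h2⟩ := exists_cell hr y
  have h1' := lt_of_le_of_ne h1 (hy j).symm
  have : tentSign r =ᶠ[𝓝 y] fun _ => (-1) ^ j := by
    filter_upwards [Ioo_mem_nhds h1' h2] with z hz
    exact tentSign_of_mem_cell hr j hz.1 hz.2
  exact continuousAt_const.congr this.symm

/-! ### Forces extended by zero to all times. -/

/-- A Carathéodory right-hand side supported in `[0, T]`, bounded by the integrable function `m`
and Lipschitz in space with the integrable coefficient `α`. -/
structure IsForcing (T : ℝ) (F : ℝ → ℝ → ℝ) (m α : ℝ → ℝ) : Prop where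
  aemeasurable : ∀ x : ℝ, AEMeasurable (fun t => F t x)
  integrable_bound : Integrable m
  bound : ∀ t x, |F t x| ≤ m t
  integrable_lip : Integrable α
  lip : ∀ᵐ t, ∀ x y, |F t x - F t y| ≤ α t * |x - y|
  support : ∀ t, t ∉ Icc 0 T → ∀ x, F t x = 0

namespace IsForcing

variable {T : ℝ} {F : ℝ → ℝ → ℝ} {m α : ℝ → ℝ}

lemma bound_nonneg (hF : IsForcing T F m α) (t : ℝ) : 0 ≤ m t :=
  (abs_nonneg _).trans (hF.bound t 0)

lemma lip_nonneg (hF : IsForcing T F m α) : ∀ᵐ t, 0 ≤ α t := by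
  filter_upwards [hF.lip] with t ht
  simpa using (abs_nonneg _).trans (ht 1 0)

lemma continuous (hF : IsForcing T F m α) : ∀ᵐ t, Continuous (F t) := by
  filter_upwards [hF.lip] with t ht
  refine (LipschitzWith.of_dist_le_mul (K := (α t).toNNReal) fun x y => ?_).continuous
  rw [Real.dist_eq, Real.dist_eq]
  exact (ht x y).trans (mul_le_mul_of_nonneg_right (Real.le_coe_toNNReal _) (abs_nonneg _))

/-- Clear when `z` is simple, by splitting over its finitely many values; in general approximate `z`
by simple functions and use continuity of `F t`. -/
lemma aemeasurable_comp (hF : IsForcing T F m α) {z : ℝ → ℝ} (hz : Measurable z) :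
    AEMeasurable (fun t => F t (z t)) := by
  let S := SimpleFunc.approxOn z hz univ 0 (mem_univ _)
  have hS : ∀ n, AEMeasurable (fun t => F t (S n t)) := by
    intro n
    have : (fun t => F t (S n t)) =
        fun t => ∑ c ∈ (S n).range, ((S n) ⁻¹' {c}).indicator (fun t => F t c) t := by
      ext t
      rw [Finset.sum_eq_single (S n t)]
      · simp
      · intro c _ hc
        exact indicator_of_notMem (fun h => hc h.symm) _
      · intro h; exact absurd (SimpleFunc.mem_range_self _ _) h
    rw [this]
    refine Finset.aemeasurable_fun_sum _ fun c _ => ?_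
    exact (hF.aemeasurable c).indicator ((S n).measurableSet_fiber c)
  refine aemeasurable_of_tendsto_metrizable_ae atTop hS ?_
  filter_upwards [hF.continuous] with t ht
  exact (ht.tendsto _).comp (SimpleFunc.tendsto_approxOn hz _ (by simp))

lemma integrable_comp (hF : IsForcing T F m α) {z : ℝ → ℝ} (hz : Measurable z) :
    Integrable (fun t => F t (z t)) :=
  hF.integrable_bound.mono' (hF.aemeasurable_comp hz).aestronglyMeasurable
    (Eventually.of_forall fun t => by simpa using hF.bound t (z t))

end IsForcing

/-! ### The unfolded equation and its a priori bounds. -/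

/-- The right-hand side of the equation on the unfolded line. -/
noncomputable def unfoldForce (r : ℝ) (F : ℝ → ℝ → ℝ) (t y : ℝ) : ℝ :=
  tentSign r y * F t (tent r y)

namespace IsForcing

variable {T : ℝ} {F : ℝ → ℝ → ℝ} {m α : ℝ → ℝ}

lemma abs_unfoldForce_le (hF : IsForcing T F m α) (r t y : ℝ) : |unfoldForce r F t y| ≤ m t := by
  rw [unfoldForce, abs_mul, abs_tentSign, one_mul]
  exact hF.bound _ _

lemma integrable_unfoldForce (hF : IsForcing T F m α) (r : ℝ) {z : ℝ → ℝ} (hz : Measurable z) :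
    Integrable (fun t => unfoldForce r F t (z t)) := by
  refine hF.integrable_bound.mono' ?_ (Eventually.of_forall fun t => by
    simpa using hF.abs_unfoldForce_le r t (z t))
  exact (((measurable_tentSign r).comp hz).aemeasurable.mul
    (hF.aemeasurable_comp ((continuous_tent r).measurable.comp hz))).aestronglyMeasurable

lemma unfoldForce_eq_zero (hF : IsForcing T F m α) (r : ℝ) {t : ℝ} (ht : t ∉ Icc 0 T) (y : ℝ) :
    unfoldForce r F t y = 0 := by
  rw [unfoldForce, hF.support t ht, mul_zero]

lemma abs_integral_unfoldForce_le (hF : IsForcing T F m α) (r : ℝ) {z : ℝ → ℝ}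
    (hz : Measurable z) (a b : ℝ) :
    |∫ s in a..b, unfoldForce r F s (z s)| ≤ ∫ s, m s := by
  have hi := (hF.integrable_unfoldForce r hz).norm
  rw [← Real.norm_eq_abs]
  refine (intervalIntegral.norm_integral_le_integral_norm_uIoc).trans
    ((setIntegral_le_integral hi (Eventually.of_forall fun _ => norm_nonneg _)).trans ?_)
  exact integral_mono hi hF.integrable_bound fun t => by simpa using hF.abs_unfoldForce_le r t (z t)

end IsForcing

/-- `Y` moves on the unfolded line with velocity `p`, initial position `0` and initial velocity `u`,
under the unfolded force evaluated at the position delayed by `h`. -/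
structure IsUnfolded (r : ℝ) (F : ℝ → ℝ → ℝ) (u h : ℝ) (Y p : ℝ → ℝ) : Prop where
  continuous_vel : Continuous p
  pos : ∀ t, Y t = ∫ s in (0 : ℝ)..t, p s
  vel : ∀ t, p t = u + ∫ s in (0 : ℝ)..t, unfoldForce r F s (Y (s - h))

namespace IsUnfolded

variable {T r u h : ℝ} {F : ℝ → ℝ → ℝ} {m α Y p : ℝ → ℝ}

lemma hasDerivAt (hY : IsUnfolded r F u h Y p) (t : ℝ) : HasDerivAt Y (p t) t := by
  have : Y = fun t => ∫ s in (0 : ℝ)..t, p s := funext hY.pos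
  rw [this]
  exact intervalIntegral.integral_hasDerivAt_right (hY.continuous_vel.intervalIntegrable _ _)
    hY.continuous_vel.aestronglyMeasurable.stronglyMeasurableAtFilter
    hY.continuous_vel.continuousAt

lemma continuous (hY : IsUnfolded r F u h Y p) : Continuous Y :=
  continuous_iff_continuousAt.2 fun t => (hY.hasDerivAt t).continuousAt

lemma pos_zero (hY : IsUnfolded r F u h Y p) : Y 0 = 0 := by simp [hY.pos]

lemma vel_zero (hY : IsUnfolded r F u h Y p) : p 0 = u := by simp [hY.vel]

lemma abs_vel_sub_le (hF : IsForcing T F m α) (hY : IsUnfolded r F u h Y p) (t : ℝ) :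
    |p t - u| ≤ ∫ s, m s := by
  rw [hY.vel, add_sub_cancel_left]
  exact hF.abs_integral_unfoldForce_le r (z := fun s => Y (s - h))
    (hY.continuous.comp (by fun_prop)).measurable 0 t

lemma le_vel (hF : IsForcing T F m α) (hY : IsUnfolded r F u h Y p) (t : ℝ) :
    u - ∫ s, m s ≤ p t := by
  have := (abs_le.1 (hY.abs_vel_sub_le hF t)).1
  linarith

lemma mul_le_sub (hF : IsForcing T F m α) (hY : IsUnfolded r F u h Y p) {s t : ℝ} (hst : s ≤ t) :
    (u - ∫ s, m s) * (t - s) ≤ Y t - Y s := by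
  have := Convex.mul_sub_le_image_sub_of_le_deriv convex_univ hY.continuous.continuousOn
    (fun t _ => (hY.hasDerivAt t).differentiableAt.differentiableWithinAt)
    (fun t _ => by rw [(hY.hasDerivAt t).deriv]; exact hY.le_vel hF t) s (mem_univ _) t
    (mem_univ _) hst
  exact this

/-- The force can change the velocity by at most `∫ m`, so the velocity stays above a positive
constant. -/
lemma strictMono (hF : IsForcing T F m α) (hY : IsUnfolded r F u h Y p) (hu : ∫ s, m s < u) :
    StrictMono Y := by
  intro s t hst
  have := hY.mul_le_sub hF hst.le
  have : 0 < (u - ∫ s, m s) * (t - s) := mul_pos (by linarith) (by linarith)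
  linarith

lemma vel_pos (hF : IsForcing T F m α) (hY : IsUnfolded r F u h Y p) (hu : ∫ s, m s < u) (t : ℝ) :
    0 < p t := by
  have := hY.le_vel hF t
  linarith

lemma abs_sub_le (hF : IsForcing T F m α) (hY : IsUnfolded r F u h Y p) {C : ℝ} (hC : |u| ≤ C)
    (s t : ℝ) : |Y t - Y s| ≤ (C + ∫ s, m s) * |t - s| := by
  refine Convex.norm_image_sub_le_of_norm_hasDerivWithin_le (s := univ)
    (fun t _ => (hY.hasDerivAt t).hasDerivWithinAt) (fun t _ => ?_) convex_univ (mem_univ _)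
    (mem_univ _)
  have h1 := hY.abs_vel_sub_le hF t
  have h2 := abs_sub_abs_le_abs_sub (p t) u
  rw [Real.norm_eq_abs]
  linarith

end IsUnfolded

lemma tendsto_unfoldForce {r : ℝ} {F : ℝ → ℝ → ℝ} (hr : 0 < r) {z : ℝ → ℝ} {s : ℝ} (hs : Continuous (F s))
    (hz : ∀ i : ℤ, z s ≠ 2 * r * i - r) {w : ℕ → ℝ} (hw : Tendsto w atTop (𝓝 (z s))) :
    Tendsto (fun n => unfoldForce r F s (w n)) atTop (𝓝 (unfoldForce r F s (z s))) := by
  have : ContinuousAt (unfoldForce r F s) (z s) :=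
    (continuousAt_tentSign hr hz).mul (hs.comp (continuous_tent r)).continuousAt
  exact this.tendsto.comp hw

/-! ### Compactness of unfolded motions. -/

/-- Compactness of the set of (delayed) unfolded motions. -/
lemma IsForcing.exists_subseq_tendsto {T r u : ℝ} {F : ℝ → ℝ → ℝ} {m α : ℝ → ℝ}
    (hF : IsForcing T F m α) (hr : 0 < r) (hT : 0 ≤ T) (hu : ∫ s, m s < u) {v h : ℕ → ℝ}
    (hv : Tendsto v atTop (𝓝 u)) (hh : Tendsto h atTop (𝓝 0)) {Y p : ℕ → ℝ → ℝ}
    (hY : ∀ n, IsUnfolded r F (v n) (h n) (Y n) (p n)) :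
    ∃ φ : ℕ → ℕ, StrictMono φ ∧ ∃ X q : ℝ → ℝ, IsUnfolded r F u 0 X q ∧
      ∀ t ∈ Icc 0 T, Tendsto (fun n => Y (φ n) t) atTop (𝓝 (X t)) := by
  obtain ⟨C₀, hC₀⟩ : ∃ C₀, ∀ n, |v n| ≤ C₀ := by
    obtain ⟨C, hC⟩ := (Metric.isBounded_range_of_tendsto v hv).exists_norm_le
    exact ⟨C, fun n => by simpa using hC _ (mem_range_self n)⟩
  set M := ∫ s, m s with hM
  have hM0 : 0 ≤ M := integral_nonneg hF.bound_nonneg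
  set C := C₀ + M
  have hC0 : 0 ≤ C := add_nonneg ((abs_nonneg _).trans (hC₀ 0)) hM0
  have hLip : ∀ n s t, |Y n t - Y n s| ≤ C * |t - s| := fun n s t => (hY n).abs_sub_le hF (hC₀ n) s t
  let y : ℕ → BoundedContinuousFunction (Icc (0 : ℝ) T) ℝ := fun n =>
    BoundedContinuousFunction.mkOfCompact ⟨fun t => Y n t, (hY n).continuous.comp continuous_subtype_val⟩
  have hcomp : IsCompact (closure (range y)) := by
    refine BoundedContinuousFunction.arzela_ascoli (Icc (-(C * T)) (C * T)) isCompact_Icc _ ?_ ?_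
    · rintro _ t ⟨n, rfl⟩
      have h1 := hLip n 0 t
      rw [(hY n).pos_zero, sub_zero, sub_zero, abs_of_nonneg t.2.1] at h1
      exact abs_le.1 (h1.trans (mul_le_mul_of_nonneg_left t.2.2 hC0))
    · refine (LipschitzWith.uniformEquicontinuous _ C.toNNReal ?_).equicontinuous
      rintro ⟨_, n, rfl⟩
      refine LipschitzWith.of_dist_le_mul fun s t => ?_
      rw [Real.coe_toNNReal _ hC0]
      exact hLip n t s
  obtain ⟨g, -, φ, hφ, hg⟩ := hcomp.tendsto_subseq fun n => subset_closure (mem_range_self n)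
  set z : ℝ → ℝ := fun t => g (projIcc 0 T hT t) with hz
  have hzc : Continuous z := g.continuous.comp continuous_projIcc
  have hlim : ∀ t ∈ Icc 0 T, Tendsto (fun n => Y (φ n) t) atTop (𝓝 (z t)) := by
    intro t ht
    have := (BoundedContinuousFunction.tendsto_iff_tendstoUniformly.1 hg).tendsto_at ⟨t, ht⟩
    simp only [hz, projIcc_of_mem hT ht]
    exact this
  have hφt := hφ.tendsto_atTop
  have hlim' : ∀ t ∈ Icc 0 T, Tendsto (fun n => Y (φ n) (t - h (φ n))) atTop (𝓝 (z t)) := by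
    intro t ht
    have h0 : Tendsto (fun n => Y (φ n) (t - h (φ n)) - Y (φ n) t) atTop (𝓝 0) := by
      refine squeeze_zero_norm (a := fun n => C * |h (φ n)|) (fun n => ?_) ?_
      · have := hLip (φ n) t (t - h (φ n))
        rwa [sub_sub_cancel_left, abs_neg] at this
      · simpa using ((hh.comp hφt).abs).const_mul C
    simpa using h0.add (hlim t ht)
  -- The lower velocity bound survives the limit, so `z` is injective on `[0, T]` and hits the
  -- countable set of walls at countably many times. Off these times the force converges.
  have hslope : ∀ s ∈ Icc 0 T, ∀ t ∈ Icc 0 T, s ≤ t → (u - M) * (t - s) ≤ z t - z s := by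
    intro s hs t ht hst
    exact le_of_tendsto_of_tendsto' (((hv.comp hφt).sub_const M).mul_const (t - s))
      ((hlim t ht).sub (hlim s hs)) fun n => (hY (φ n)).mul_le_sub hF hst
  have hinj : StrictMonoOn z (Icc 0 T) := by
    intro s hs t ht hst
    have h1 := hslope s hs t ht hst.le
    have : 0 < (u - M) * (t - s) := mul_pos (by linarith) (by linarith)
    linarith
  have hwall : ∀ᵐ s, s ∈ Icc 0 T → ∀ i : ℤ, z s ≠ 2 * r * i - r := by
    have hc : {s | s ∈ Icc 0 T ∧ ∃ i : ℤ, z s = 2 * r * i - r}.Countable := by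
      refine MapsTo.countable_of_injOn (t := range fun i : ℤ => 2 * r * (i : ℝ) - r) (f := z) ?_
        (hinj.injOn.mono fun s hs => hs.1) (countable_range _)
      rintro s ⟨_, i, hi⟩
      exact ⟨i, hi.symm⟩
    filter_upwards [hc.ae_notMem volume] with s hs hs' i hi
    exact hs ⟨hs', i, hi⟩
  have hvel : ∀ t, Tendsto (fun n => p (φ n) t) atTop
      (𝓝 (u + ∫ s in (0 : ℝ)..t, unfoldForce r F s (z s))) := by
    intro t
    have e : (fun n => p (φ n) t) = fun n => v (φ n) +
        ∫ s in (0 : ℝ)..t, unfoldForce r F s (Y (φ n) (s - h (φ n))) :=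
      funext fun n => (hY (φ n)).vel t
    rw [e]
    refine (hv.comp hφt).add
      (intervalIntegral.tendsto_integral_filter_of_dominated_convergence m ?_ ?_ ?_ ?_)
    · refine Eventually.of_forall fun n => ?_
      exact (hF.integrable_unfoldForce r (z := fun s => Y (φ n) (s - h (φ n)))
        ((hY _).continuous.comp (by fun_prop)).measurable).aestronglyMeasurable.restrict
    · exact Eventually.of_forall fun n => Eventually.of_forall fun s _ => by
        simpa using hF.abs_unfoldForce_le r s _
    · exact hF.integrable_bound.intervalIntegrable
    · filter_upwards [hwall, hF.continuous] with s hs hc _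
      by_cases hsT : s ∈ Icc 0 T
      · exact tendsto_unfoldForce hr hc (hs hsT) (hlim' s hsT)
      · simp [hF.unfoldForce_eq_zero r hsT]
  set q : ℝ → ℝ := fun t => u + ∫ s in (0 : ℝ)..t, unfoldForce r F s (z s) with hq
  have hqc : Continuous q := by
    have := hF.integrable_unfoldForce r hzc.measurable
    exact continuous_const.add
      (intervalIntegral.continuous_primitive (fun a b => this.intervalIntegrable) 0)
  have hpos : ∀ t ∈ Icc 0 T, ∫ s in (0 : ℝ)..t, q s = z t := by
    intro t ht
    refine tendsto_nhds_unique ?_ (hlim t ht)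
    have e : (fun n => Y (φ n) t) = fun n => ∫ s in (0 : ℝ)..t, p (φ n) s :=
      funext fun n => (hY (φ n)).pos t
    rw [e]
    refine intervalIntegral.tendsto_integral_filter_of_dominated_convergence (fun _ => C)
      (Eventually.of_forall fun n => (hY _).continuous_vel.aestronglyMeasurable)
      (Eventually.of_forall fun n => Eventually.of_forall fun s _ => ?_)
      intervalIntegrable_const (Eventually.of_forall fun s _ => hvel s)
    have h1 := (hY (φ n)).abs_vel_sub_le hF s
    have h2 := abs_sub_abs_le_abs_sub (p (φ n) s) (v (φ n))
    have h3 := hC₀ (φ n)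
    rw [Real.norm_eq_abs]
    linarith
  -- The limit is taken as the primitive of `q`, because `z` is frozen outside `[0, T]`. The two
  -- agree on `[0, T]`, and elsewhere the force vanishes.
  refine ⟨φ, hφ, fun t => ∫ s in (0 : ℝ)..t, q s, q, ⟨hqc, fun t => rfl, fun t => ?_⟩, fun t ht => ?_⟩
  · refine congrArg (u + ·) (intervalIntegral.integral_congr fun s _ => ?_)
    by_cases hsT : s ∈ Icc 0 T
    · simp only [sub_zero, hpos s hsT]
    · simp only [hF.unfoldForce_eq_zero r hsT]
  · simpa only [hpos t ht] using hlim t ht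

/-! ### Existence by delay. -/

/-- Successive approximations of the delayed unfolded motion. -/
noncomputable def delayedIterate (r : ℝ) (F : ℝ → ℝ → ℝ) (u h : ℝ) : ℕ → ℝ → ℝ
  | 0 => fun t => u * t
  | n + 1 => fun t => ∫ τ in (0 : ℝ)..t,
      (u + ∫ s in (0 : ℝ)..τ, unfoldForce r F s (delayedIterate r F u h n (s - h)))

namespace IsForcing

variable {T r : ℝ} {F : ℝ → ℝ → ℝ} {m α : ℝ → ℝ}

lemma continuous_vel_of_continuous (hF : IsForcing T F m α) (r u h : ℝ) {z : ℝ → ℝ}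
    (hz : Continuous z) :
    Continuous fun τ => u + ∫ s in (0 : ℝ)..τ, unfoldForce r F s (z (s - h)) := by
  have := hF.integrable_unfoldForce r (z := fun s => z (s - h)) (hz.comp (by fun_prop)).measurable
  exact continuous_const.add
    (intervalIntegral.continuous_primitive (fun a b => this.intervalIntegrable) 0)

lemma continuous_delayedIterate (hF : IsForcing T F m α) (r u h : ℝ) (n : ℕ) :
    Continuous (delayedIterate r F u h n) := by
  induction n with
  | zero => exact continuous_const.mul continuous_id
  | succ n ih =>
    exact intervalIntegral.continuous_primitive
      (fun a b => (hF.continuous_vel_of_continuous r u h ih).intervalIntegrable a b) 0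

/-- Method of steps: up to time `(n + 1) * h` the delayed force sees positions only up to `n * h`,
so each iteration settles one more interval of length `h`. For `t ≤ 0` the start `u * t` is already
exact, as there is no force before time `0`. -/
lemma delayedIterate_succ_eq (hF : IsForcing T F m α) (r u : ℝ) {h : ℝ} (hh : 0 ≤ h) (n : ℕ) :
    ∀ t ≤ n * h, delayedIterate r F u h (n + 1) t = delayedIterate r F u h n t := by
  induction n with
  | zero =>
    intro t ht
    have ht : t ≤ 0 := by simpa using ht
    have key : ∀ τ ∈ uIcc 0 t, (u + ∫ s in (0 : ℝ)..τ,
        unfoldForce r F s (delayedIterate r F u h 0 (s - h))) = u := by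
      intro τ hτ
      rw [uIcc_of_ge ht] at hτ
      rw [add_eq_left, intervalIntegral.integral_symm, neg_eq_zero]
      rw [intervalIntegral.integral_of_le hτ.2, integral_Ioc_eq_integral_Ioo]
      refine setIntegral_eq_zero_of_forall_eq_zero fun s hs => ?_
      exact hF.unfoldForce_eq_zero r (fun h => absurd h.1 (not_le.2 hs.2)) _
    refine (intervalIntegral.integral_congr key).trans ?_
    simp [delayedIterate, mul_comm]
  | succ n ih =>
    intro t ht
    refine intervalIntegral.integral_congr fun τ hτ => congrArg (u + ·)
      (intervalIntegral.integral_congr fun s hs => congrArg (unfoldForce r F s) (ih _ ?_))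
    have h1 : τ ≤ max 0 t := hτ.2
    have h2 : s ≤ max 0 τ := hs.2
    have h3 : s ≤ (n + 1 : ℕ) * h :=
      h2.trans (max_le (by positivity) (h1.trans (max_le (by positivity) ht)))
    push_cast at h3
    linarith

lemma exists_isUnfolded_delayed (hF : IsForcing T F m α) (r u : ℝ) {h : ℝ} (hh : 0 < h) :
    ∃ Y p, IsUnfolded r F u h Y p := by
  -- With `n * h ≥ T` the iterates `n` and `n + 1` agree wherever the force acts.
  obtain ⟨n, hn⟩ := exists_nat_ge (T / h)
  rw [div_le_iff₀ hh] at hn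
  have hc := hF.continuous_delayedIterate r u h n
  refine ⟨delayedIterate r F u h (n + 1), _, hF.continuous_vel_of_continuous r u h hc,
    fun t => rfl, fun t => ?_⟩
  refine congrArg (u + ·) (intervalIntegral.integral_congr fun s _ => ?_)
  by_cases hsT : s ∈ Icc 0 T
  · refine congrArg (unfoldForce r F s) (hF.delayedIterate_succ_eq r u hh.le n _ ?_).symm
    linarith [hsT.2]
  · simp only [hF.unfoldForce_eq_zero r hsT]

lemma exists_isUnfolded (hF : IsForcing T F m α) (hr : 0 < r) (hT : 0 ≤ T) {u : ℝ}
    (hu : ∫ s, m s < u) : ∃ Y p, IsUnfolded r F u 0 Y p := by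
  choose Y p hY using fun n : ℕ =>
    hF.exists_isUnfolded_delayed r u (h := 1 / ((n : ℝ) + 1)) (by positivity)
  obtain ⟨_, _, X, q, hX, _⟩ := hF.exists_subseq_tendsto hr hT hu tendsto_const_nhds
    tendsto_one_div_add_atTop_nhds_zero_nat hY
  exact ⟨X, q, hX⟩

end IsForcing

/-! ### Folded motions are billiard motions. -/

namespace IsUnfolded

variable {T r u : ℝ} {F : ℝ → ℝ → ℝ} {m α Y p : ℝ → ℝ}

lemma vel_sub (hF : IsForcing T F m α) (hY : IsUnfolded r F u 0 Y p) (a t : ℝ) :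
    p t = p a + ∫ s in a..t, unfoldForce r F s (Y s) := by
  have hi := hF.integrable_unfoldForce r hY.continuous.measurable
  have h1 := hY.vel t
  have h2 := hY.vel a
  simp only [sub_zero] at h1 h2
  rw [h1, h2, add_assoc, intervalIntegral.integral_add_adjacent_intervals hi.intervalIntegrable
    hi.intervalIntegrable]

lemma hasDerivWithinAt_tent_right (hr : 0 < r) (hY : IsUnfolded r F u 0 Y p) (hmono : StrictMono Y)
    {t : ℝ} {i : ℤ} (h1 : 2 * r * i - r ≤ Y t) (h2 : Y t < 2 * r * i + r) :
    HasDerivWithinAt (fun s => tent r (Y s)) ((-1) ^ i * p t) (Ici t) t := by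
  have h : HasDerivWithinAt (fun s => (-1 : ℝ) ^ i * (Y s - 2 * r * i)) ((-1) ^ i * p t) (Ici t) t :=
    (((hY.hasDerivAt t).sub_const _).const_mul _).hasDerivWithinAt
  refine h.congr_of_eventuallyEq ?_ (tent_of_mem_cell hr i h1 h2.le)
  filter_upwards [self_mem_nhdsWithin,
    nhdsWithin_le_nhds (hY.continuous.continuousAt.eventually_lt_const h2)] with s hs hs2
  exact tent_of_mem_cell hr i (h1.trans (hmono.monotone hs)) hs2.le

lemma hasDerivWithinAt_tent_left (hr : 0 < r) (hY : IsUnfolded r F u 0 Y p) (hmono : StrictMono Y)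
    {t : ℝ} {i : ℤ} (h1 : 2 * r * i - r < Y t) (h2 : Y t ≤ 2 * r * i + r) :
    HasDerivWithinAt (fun s => tent r (Y s)) ((-1) ^ i * p t) (Iic t) t := by
  have h : HasDerivWithinAt (fun s => (-1 : ℝ) ^ i * (Y s - 2 * r * i)) ((-1) ^ i * p t) (Iic t) t :=
    (((hY.hasDerivAt t).sub_const _).const_mul _).hasDerivWithinAt
  refine h.congr_of_eventuallyEq ?_ (tent_of_mem_cell hr i h1.le h2)
  filter_upwards [self_mem_nhdsWithin,
    nhdsWithin_le_nhds (hY.continuous.continuousAt.eventually_const_lt h1)] with s hs hs2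
  exact tent_of_mem_cell hr i hs2.le ((hmono.monotone hs).trans h2)

/-- A motion that stays away from the walls stays in one cell. -/
lemma exists_cell_of_tent_mem_Ioo (hr : 0 < r) (hY : IsUnfolded r F u 0 Y p) (hmono : StrictMono Y)
    {a b : ℝ} (hab : a ≤ b) (h : ∀ t ∈ Icc a b, tent r (Y t) ∈ Ioo (-r) r) :
    ∃ i : ℤ, ∀ t ∈ Icc a b, 2 * r * i - r < Y t ∧ Y t < 2 * r * i + r := by
  have hwall : ∀ t ∈ Icc a b, ∀ i : ℤ, Y t ≠ 2 * r * i - r := by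
    intro t ht i hi
    rcases (tent_eq_wall_iff hr (Y t)).2 ⟨i, hi⟩ with h' | h'
    · exact (h t ht).1.ne' h'
    · exact (h t ht).2.ne h'
  obtain ⟨i, h1, h2⟩ := exists_cell hr (Y a)
  refine ⟨i, fun t ht => ⟨(lt_of_le_of_ne h1 (hwall a ⟨le_rfl, hab⟩ i).symm).trans_le
    (hmono.monotone ht.1), ?_⟩⟩
  by_contra! hlt
  obtain ⟨s, hs, hs'⟩ := intermediate_value_Icc ht.1 hY.continuous.continuousOn ⟨h2.le, hlt⟩
  refine hwall s ⟨hs.1, hs.2.trans ht.2⟩ (i + 1) ?_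
  rw [hs']; push_cast; ring

/-- Folding an unfolded motion gives a billiard motion. -/
lemma isBilliardSolution (hF : IsForcing T F m α) (hr : 0 < r) (hu : ∫ s, m s < u)
    (hY : IsUnfolded r F u 0 Y p) : IsBilliardSolution r T F fun t => tent r (Y t) := by
  have hmono := hY.strictMono hF hu
  refine ⟨((continuous_tent r).comp hY.continuous).continuousOn, fun t _ => tent_mem hr _, ?_, ?_⟩
  · intro a b _ hab _ hint
    obtain ⟨i, hi⟩ := hY.exists_cell_of_tent_mem_Ioo hr hmono hab.le hint
    have hG := hF.integrable_unfoldForce r hY.continuous.measurable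
    have hpe : p = fun t => p a + ∫ s in a..t, unfoldForce r F s (Y s) :=
      funext fun t => hY.vel_sub hF a t
    refine ⟨fun t => (-1) ^ i * p t, ?_, fun t ht => ?_, ?_⟩
    · refine AbsolutelyContinuousOnInterval.const_mul _ ?_
      rw [hpe]
      refine AbsolutelyContinuousOnInterval.add ?_
        (hG.intervalIntegrable.absolutelyContinuousOnInterval_intervalIntegral left_mem_uIcc)
      exact (LipschitzWith.const (p a)).lipschitzOnWith.absolutelyContinuousOnInterval
    · have h : HasDerivWithinAt (fun s => (-1 : ℝ) ^ i * (Y s - 2 * r * i)) ((-1) ^ i * p t)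
          (Icc a b) t := (((hY.hasDerivAt t).sub_const _).const_mul _).hasDerivWithinAt
      exact h.congr (fun s hs => tent_of_mem_cell hr i (hi s hs).1.le (hi s hs).2.le)
        (tent_of_mem_cell hr i (hi t ht).1.le (hi t ht).2.le)
    · rw [ae_restrict_iff' measurableSet_Icc]
      filter_upwards [LocallyIntegrable.ae_hasDerivAt_integral hG.locallyIntegrable] with t ht hmem
      have h1 := ((ht a).const_add (p a)).const_mul ((-1 : ℝ) ^ i)
      simp only [← hY.vel_sub hF a] at h1
      have h2 : (-1 : ℝ) ^ i * unfoldForce r F t (Y t) = F t (tent r (Y t)) := by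
        rw [unfoldForce, tentSign_of_mem_cell hr i (hi t hmem).1 (hi t hmem).2, ← mul_assoc,
          ← zpow_add₀ (by norm_num), (Even.add_self i).neg_one_zpow, one_mul]
      rwa [h2] at h1
  · intro s _ hs
    obtain ⟨i, hi⟩ := (tent_eq_wall_iff hr (Y s)).1 hs
    -- The wall separates cell `i - 1` from cell `i`. The signs of neighbouring cells are opposite,
    -- which is the impact law.
    have hl := hY.hasDerivWithinAt_tent_left hr hmono (t := s) (i := i - 1)
      (by rw [hi]; push_cast; linarith) (by rw [hi]; push_cast; linarith)
    have hR := hY.hasDerivWithinAt_tent_right hr hmono (t := s) (i := i)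
      (by rw [hi]) (by rw [hi]; linarith)
    refine ⟨_, hl, ?_⟩
    convert hR using 1
    rw [zpow_sub_one₀ (by norm_num)]
    norm_num

end IsUnfolded

/-! ### Uniqueness for the billiard. -/

lemma IsForcing.integrable_comp_of_continuousOn {T : ℝ} {F : ℝ → ℝ → ℝ} {m α : ℝ → ℝ}
    (hF : IsForcing T F m α) (hT : 0 ≤ T) {x : ℝ → ℝ} (hx : ContinuousOn x (Icc 0 T)) :
    Integrable fun s => F s (x s) := by
  have hc : Continuous (IccExtend hT ((Icc 0 T).domRestrict x)) := hx.domRestrict.Icc_extend'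
  refine (hF.integrable_comp hc.measurable).congr (Eventually.of_forall fun s => ?_)
  by_cases hs : s ∈ Icc 0 T
  · simp only [IccExtend_of_mem hT _ hs, domRestrict_apply]
  · simp only [hF.support s hs]

/-- Between impacts, a billiard motion is determined by the twice integrated equation, started at
its position and right derivative at the initial time, which may be an impact. -/
lemma IsBilliardSolution.eq_integral {T r q a b : ℝ} {F : ℝ → ℝ → ℝ} {m α x : ℝ → ℝ}
    (hF : IsForcing T F m α) (hT : 0 ≤ T) (hx : IsBilliardSolution r T F x) (ha : 0 ≤ a)
    (hab : a < b) (hb : b ≤ T) (hint : ∀ t ∈ Ioc a b, x t ∈ Ioo (-r) r)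
    (hq : HasDerivWithinAt x q (Ici a) a) :
    ∀ t ∈ Icc a b, x t = x a + ∫ τ in a..t, (q + ∫ s in a..τ, F s (x s)) := by
  have hG := hF.integrable_comp_of_continuousOn hT hx.continuousOn
  set V : ℝ → ℝ := fun t => ∫ s in a..t, F s (x s) with hV
  have hVc : Continuous V :=
    intervalIntegral.continuous_primitive (fun _ _ => hG.intervalIntegrable) a
  set W : ℝ → ℝ := fun t => ∫ τ in a..t, V τ with hW
  have hWd : ∀ t, HasDerivAt W (V t) t := fun t =>
    intervalIntegral.integral_hasDerivAt_right (hVc.intervalIntegrable _ _)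
      hVc.aestronglyMeasurable.stronglyMeasurableAtFilter hVc.continuousAt
  have hWc : Continuous W := continuous_iff_continuousAt.2 fun t => (hWd t).continuousAt
  have hxc : ContinuousOn x (Icc a b) := hx.continuousOn.mono (Icc_subset_Icc ha hb)
  set D : ℝ → ℝ := fun t => x t - W t with hD
  have hDc : ContinuousOn D (Icc a b) := hxc.sub hWc.continuousOn
  -- `x a` may be on the wall, so the equation is available only on `[c, b]` with `c > a`. There `x`
  -- minus the twice integrated force is affine; the slope does not depend on `c`, the formula
  -- extends to `a` by continuity, and the right derivative at `a` identifies the slope.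
  have haff : ∀ c ∈ Ioo a b, ∃ κ, ∀ t ∈ Icc c b, D t = D b + κ * (t - b) := by
    intro c hc
    obtain ⟨w, hwac, hwd, hwae⟩ := hx.ode c b (ha.trans hc.1.le) hc.2 hb
      fun t ht => hint t ⟨hc.1.trans_le ht.1, ht.2⟩
    rw [ae_restrict_iff' measurableSet_Icc] at hwae
    have hwV : ∀ t ∈ Icc c b, w t - V t = w c - V c := by
      intro t ht
      have h1 := (hwac.mono (c := c) (d := t) (by
        rw [uIcc_of_le ht.1, uIcc_of_le hc.2.le]
        exact Icc_subset_Icc_right ht.2)).integral_deriv_eq_sub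
      have h2 : ∫ s in c..t, deriv w s = ∫ s in c..t, F s (x s) := by
        refine intervalIntegral.integral_congr_ae ?_
        filter_upwards [hwae] with s hs hs'
        rw [uIoc_of_le ht.1] at hs'
        exact (hs ⟨hs'.1.le, hs'.2.trans ht.2⟩).deriv
      have h3 : V t - V c = ∫ s in c..t, F s (x s) :=
        intervalIntegral.integral_interval_sub_left hG.intervalIntegrable hG.intervalIntegrable
      linarith
    refine ⟨w c - V c, ?_⟩
    have hconst := constant_of_has_deriv_right_zero (f := fun t => D t - (w c - V c) * t)
      (a := c) (b := b) ((hDc.mono (Icc_subset_Icc_left hc.1.le)).sub (by fun_prop)) (by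
        intro t ht
        have h1 : HasDerivWithinAt x (w t) (Ici t) t :=
          (hwd t ⟨ht.1, ht.2.le⟩).mono_of_mem_nhdsWithin
            (mem_of_superset (Icc_mem_nhdsGE ht.2) (Icc_subset_Icc_left ht.1))
        have h2 := (h1.sub (hWd t).hasDerivWithinAt).sub
          ((hasDerivWithinAt_id t (Ici t)).const_mul (w c - V c))
        rwa [hwV t ⟨ht.1, ht.2.le⟩, mul_one, sub_self] at h2)
    intro t ht
    have h1 := hconst t ht
    have h2 := hconst b ⟨hc.2.le, le_rfl⟩
    linarith
  obtain ⟨c, hc⟩ := exists_between hab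
  obtain ⟨κ, hκ⟩ := haff c hc
  have haff' : EqOn D (fun t => D b + κ * (t - b)) (Ioc a b) := by
    intro t ht
    by_cases htc : c ≤ t
    · exact hκ t ⟨htc, ht.2⟩
    · push Not at htc
      obtain ⟨κ', hκ'⟩ := haff t ⟨ht.1, htc.trans hc.2⟩
      have h1 := hκ' c ⟨htc.le, hc.2.le⟩
      rw [hκ c ⟨le_rfl, hc.2.le⟩] at h1
      have : κ = κ' := mul_right_cancel₀ (sub_ne_zero.2 hc.2.ne) (add_left_cancel h1)
      rw [hκ' t ⟨le_rfl, ht.2⟩, this]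
  have haff'' : EqOn D (fun t => D b + κ * (t - b)) (Icc a b) :=
    haff'.of_subset_closure hDc (by fun_prop) Ioc_subset_Icc_self (by
      rw [closure_Ioc hab.ne])
  have hκq : q = κ := by
    have h1 : HasDerivWithinAt D (q - V a) (Icc a b) a :=
      (hq.mono Icc_subset_Ici_self).sub (hWd a).hasDerivWithinAt
    have h2 : HasDerivWithinAt D (κ * 1) (Icc a b) a :=
      ((((hasDerivWithinAt_id a (Icc a b)).sub_const b).const_mul κ).const_add (D b)).congr haff''
        (haff'' ⟨le_rfl, hab.le⟩)
    have h3 := (uniqueDiffOn_Icc hab a ⟨le_rfl, hab.le⟩).eq_deriv _ h1 h2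
    have h4 : V a = 0 := intervalIntegral.integral_same
    linarith
  intro t ht
  have h1 := haff'' ht
  have h2 := haff'' (x := a) ⟨le_rfl, hab.le⟩
  have hWa : W a = 0 := intervalIntegral.integral_same
  have h3 : ∫ τ in a..t, (q + V τ) = q * (t - a) + W t := by
    rw [intervalIntegral.integral_add intervalIntegrable_const (hVc.intervalIntegrable _ _)]
    simp [hW, mul_comm]
  rw [h3, hκq]
  simp only [hD] at h1 h2
  linarith

/-- Uniqueness on short intervals for the twice integrated equation. -/
lemma IsForcing.eqOn_of_eq_integral {T q c a b : ℝ} {F : ℝ → ℝ → ℝ} {m α x y : ℝ → ℝ}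
    (hF : IsForcing T F m α) (hT : 0 ≤ T) (hx : ContinuousOn x (Icc 0 T))
    (hy : ContinuousOn y (Icc 0 T)) (ha : 0 ≤ a) (hab : a ≤ b) (hb : b ≤ T)
    (hsmall : (b - a) * ∫ s, α s < 1)
    (hxe : ∀ t ∈ Icc a b, x t = c + ∫ τ in a..t, (q + ∫ s in a..τ, F s (x s)))
    (hye : ∀ t ∈ Icc a b, y t = c + ∫ τ in a..t, (q + ∫ s in a..τ, F s (y s))) :
    EqOn x y (Icc a b) := by
  have hGx := hF.integrable_comp_of_continuousOn hT hx
  have hGy := hF.integrable_comp_of_continuousOn hT hy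
  have hsub := Icc_subset_Icc ha hb
  obtain ⟨t₀, ht₀, hmax⟩ := isCompact_Icc.exists_isMaxOn (nonempty_Icc.2 hab)
    (((hx.mono hsub).sub (hy.mono hsub)).abs)
  set δ := |x t₀ - y t₀| with hδ
  have hδ0 : 0 ≤ δ := abs_nonneg _
  have hle : ∀ s ∈ Icc a b, |x s - y s| ≤ δ := fun s hs => hmax hs
  set A := ∫ s, α s with hA
  have hinner : ∀ τ ∈ Icc a b,
      |(∫ s in a..τ, F s (x s)) - ∫ s in a..τ, F s (y s)| ≤ A * δ := by
    intro τ hτ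
    rw [← intervalIntegral.integral_sub hGx.intervalIntegrable hGy.intervalIntegrable,
      ← Real.norm_eq_abs]
    refine (intervalIntegral.norm_integral_le_of_norm_le hτ.1 (g := fun s => α s * δ) ?_
      (hF.integrable_lip.mul_const δ).intervalIntegrable).trans ?_
    · filter_upwards [hF.lip, hF.lip_nonneg] with s hs hs0 hsm
      exact (hs _ _).trans (mul_le_mul_of_nonneg_left (hle s ⟨hsm.1.le, hsm.2.trans hτ.2⟩) hs0)
    · rw [intervalIntegral.integral_mul_const, intervalIntegral.integral_of_le hτ.1]
      exact mul_le_mul_of_nonneg_right (setIntegral_le_integral hF.integrable_lip hF.lip_nonneg) hδ0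
  have hc : ∀ {z : ℝ → ℝ}, Integrable (fun s => F s (z s)) →
      Continuous fun τ => q + ∫ s in a..τ, F s (z s) := fun h =>
    continuous_const.add (intervalIntegral.continuous_primitive (fun _ _ => h.intervalIntegrable) a)
  have hdiff : x t₀ - y t₀ = ∫ τ in a..t₀,
      ((q + ∫ s in a..τ, F s (x s)) - (q + ∫ s in a..τ, F s (y s))) := by
    rw [intervalIntegral.integral_sub ((hc hGx).intervalIntegrable _ _)
      ((hc hGy).intervalIntegrable _ _), hxe t₀ ht₀, hye t₀ ht₀]
    ring
  -- Contraction estimate at the point `t₀` of maximal distance: `hsmall` then forces `δ = 0`.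
  have hbound : δ ≤ A * δ * |t₀ - a| := by
    rw [← Real.norm_eq_abs] at hδ
    conv_lhs => rw [hδ, hdiff]
    refine intervalIntegral.norm_integral_le_of_norm_le_const fun τ hτ => ?_
    rw [uIoc_of_le ht₀.1] at hτ
    rw [add_sub_add_left_eq_sub]
    exact hinner τ ⟨hτ.1.le, hτ.2.trans ht₀.2⟩
  have hA0 : 0 ≤ A := integral_nonneg_of_ae hF.lip_nonneg
  have hδz : δ = 0 := by
    by_contra hne
    have hpos : 0 < δ := lt_of_le_of_ne hδ0 (Ne.symm hne)
    rw [abs_of_nonneg (sub_nonneg.2 ht₀.1)] at hbound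
    have h1 : A * (t₀ - a) ≤ A * (b - a) := mul_le_mul_of_nonneg_left (by linarith [ht₀.2]) hA0
    nlinarith
  intro t ht
  have := hle t ht
  rw [hδz] at this
  exact sub_eq_zero.1 (abs_nonpos_iff.1 this)

lemma eventually_lt_of_hasDerivWithinAt_pos {z : ℝ → ℝ} {a p : ℝ}
    (hz : HasDerivWithinAt z p (Ici a) a) (hp : 0 < p) : ∀ᶠ t in 𝓝[>] a, z a < z t := by
  have h := (hasDerivWithinAt_iff_tendsto_slope' (s := Ioi a) (lt_irrefl a)).1 hz.Ioi_of_Ici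
  filter_upwards [h.eventually_const_lt hp, self_mem_nhdsWithin] with t ht hat
  rw [slope_def_field, div_pos_iff_of_pos_right (sub_pos.2 hat)] at ht
  linarith

lemma IsBilliardSolution.exists_hasDerivWithinAt {T r a : ℝ} {F : ℝ → ℝ → ℝ} {x : ℝ → ℝ}
    (hx : IsBilliardSolution r T F x) (ha : a ∈ Ioo 0 T) (hint : x a ∈ Ioo (-r) r) :
    ∃ l, HasDerivAt x l a := by
  have hnhds : Icc 0 T ∈ 𝓝 a := Icc_mem_nhds ha.1 ha.2
  have hcont : ContinuousAt x a := hx.continuousOn.continuousAt hnhds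
  have hev : ∀ᶠ t in 𝓝 a, t ∈ Icc 0 T ∧ x t ∈ Ioo (-r) r :=
    Filter.Eventually.and hnhds (hcont.eventually (Ioo_mem_nhds hint.1 hint.2))
  obtain ⟨ε, hε, hball⟩ := Metric.nhds_basis_closedBall.eventually_iff.1 hev
  rw [Real.closedBall_eq_Icc] at hball
  obtain ⟨w, -, hw, -⟩ := hx.ode (a - ε) (a + ε) (hball ⟨le_rfl, by linarith⟩).1.1 (by linarith)
    (hball ⟨by linarith, le_rfl⟩).1.2 fun t ht => (hball ht).2
  exact ⟨w a, (hw a ⟨by linarith, by linarith⟩).hasDerivAt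
    (Icc_mem_nhds (by linarith) (by linarith))⟩

namespace IsUnfolded

variable {T r u : ℝ} {F : ℝ → ℝ → ℝ} {m α x Y p : ℝ → ℝ}

/-- A billiard motion that agrees with a folded motion up to time `a` has the same right derivative
at time `a`. -/
lemma hasDerivWithinAt_of_eqOn (hF : IsForcing T F m α) (hr : 0 < r) (hu : ∫ s, m s < u)
    (hx : IsCauchySolution r T F u x) (hY : IsUnfolded r F u 0 Y p) {a : ℝ} (ha0 : 0 ≤ a)
    (haT : a < T) (heq : EqOn x (fun t => tent r (Y t)) (Icc 0 a)) {i : ℤ}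
    (h1 : 2 * r * i - r ≤ Y a) (h2 : Y a < 2 * r * i + r) :
    HasDerivWithinAt x ((-1) ^ i * p a) (Ici a) a := by
  have hmono := hY.strictMono hF hu
  rcases ha0.eq_or_lt with rfl | hapos
  · rw [hY.pos_zero] at h1 h2
    have hi : i = 0 := by
      have h3 : (i : ℝ) < 1 := by nlinarith
      have h4 : (-1 : ℝ) < i := by nlinarith
      have h3' : i < 1 := by exact_mod_cast h3
      have h4' : -1 < i := by exact_mod_cast h4
      omega
    rw [hi, zpow_zero, one_mul, hY.vel_zero]
    exact hx.2.2
  have hxa : x a = tent r (Y a) := heq ⟨hapos.le, le_rfl⟩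
  -- The left derivative at `a` is dictated by the common past. At a wall the impact law turns it
  -- into the right derivative; inside the table the two coincide.
  have huniq : ∀ {l k : ℝ}, HasDerivWithinAt x l (Iic a) a →
      HasDerivWithinAt (fun t => tent r (Y t)) k (Iic a) a → l = k := by
    intro l k hl hk
    exact (uniqueDiffOn_Icc hapos a ⟨hapos.le, le_rfl⟩).eq_deriv _
      (hl.mono Icc_subset_Iic_self) ((hk.mono Icc_subset_Iic_self).congr heq hxa)
  by_cases hw : Y a = 2 * r * i - r
  · have hwall := (tent_eq_wall_iff hr (Y a)).2 ⟨i, hw⟩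
    rw [← hxa] at hwall
    obtain ⟨l, hl, hl'⟩ := hx.1.impact a ⟨hapos, haT⟩ hwall
    have hk := hY.hasDerivWithinAt_tent_left hr hmono (t := a) (i := i - 1)
      (by rw [hw]; push_cast; linarith) (by rw [hw]; push_cast; linarith)
    rw [huniq hl hk, zpow_sub_one₀ (by norm_num)] at hl'
    convert hl' using 1
    norm_num
  · have h1' : 2 * r * i - r < Y a := lt_of_le_of_ne h1 (Ne.symm hw)
    have hint : x a ∈ Ioo (-r) r := by
      rw [hxa, tent_of_mem_cell hr i h1 h2.le]
      rcases neg_one_zpow_cases i with h | h <;> rw [h] <;> constructor <;> linarith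
    obtain ⟨l, hl⟩ := hx.1.exists_hasDerivWithinAt ⟨hapos, haT⟩ hint
    rw [← huniq hl.hasDerivWithinAt (hY.hasDerivWithinAt_tent_left hr hmono h1' h2.le)]
    exact hl.hasDerivWithinAt

/-- A billiard motion that agrees with a folded motion up to time `a < T` agrees with it a little
longer. -/
lemma exists_eqOn_of_eqOn (hF : IsForcing T F m α) (hr : 0 < r) (hu : ∫ s, m s < u)
    (hx : IsCauchySolution r T F u x) (hY : IsUnfolded r F u 0 Y p) {a : ℝ} (ha0 : 0 ≤ a)
    (haT : a < T) (heq : EqOn x (fun t => tent r (Y t)) (Icc 0 a)) :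
    ∃ b > a, EqOn x (fun t => tent r (Y t)) (Icc a b) := by
  have hmono := hY.strictMono hF hu
  obtain ⟨i, h1, h2⟩ := exists_cell hr (Y a)
  have hxa : x a = tent r (Y a) := heq ⟨ha0, le_rfl⟩
  have hxq := hY.hasDerivWithinAt_of_eqOn hF hr hu hx ha0 haT heq h1 h2
  have hXq := hY.hasDerivWithinAt_tent_right hr hmono h1 h2
  have hsq : (-1 : ℝ) ^ i * (-1) ^ i = 1 := by
    rcases neg_one_zpow_cases i with h | h <;> rw [h] <;> norm_num
  have hza : (-1 : ℝ) ^ i * x a = Y a - 2 * r * i := by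
    rw [hxa, tent_of_mem_cell hr i h1 h2.le, ← mul_assoc, hsq, one_mul]
  have hzq : HasDerivWithinAt (fun t => (-1 : ℝ) ^ i * x t) (p a) (Ici a) a := by
    have := hxq.const_mul ((-1 : ℝ) ^ i)
    rwa [← mul_assoc, hsq, one_mul] at this
  -- After the sign change by `(-1) ^ i` the velocity at `a` is `p a > 0`, so even from a wall `x`
  -- enters the open table at once and stays there briefly, as does the folded motion. The integral
  -- equations then apply to both.
  have hz1 := eventually_lt_of_hasDerivWithinAt_pos hzq (hY.vel_pos hF hu a)
  have hz2 : ∀ᶠ t in 𝓝[>] a, (-1 : ℝ) ^ i * x t < r :=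
    (hzq.continuousWithinAt.mono Ioi_subset_Ici_self).eventually_lt_const (by linarith)
  have hY2 : ∀ᶠ t in 𝓝[>] a, Y t < 2 * r * i + r :=
    nhdsWithin_le_nhds (hY.continuous.continuousAt.eventually_lt_const h2)
  have hsmall : ∀ᶠ t in 𝓝[>] a, (t - a) * (∫ s, α s) < 1 := by
    have hc : ContinuousAt (fun t => (t - a) * ∫ s, α s) a := by fun_prop
    exact nhdsWithin_le_nhds (hc.eventually_lt_const (by simp))
  have hbT : ∀ᶠ t in 𝓝[>] a, t ≤ T :=
    nhdsWithin_le_nhds ((eventually_lt_nhds haT).mono fun _ => le_of_lt)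
  obtain ⟨b, hab, hb⟩ := mem_nhdsGT_iff_exists_Ioc_subset.1
    (hz1.and (hz2.and (hY2.and (hsmall.and hbT))))
  have hab : a < b := hab
  obtain ⟨-, -, -, hbs, hbT⟩ := hb ⟨hab, le_rfl⟩
  have hT : 0 ≤ T := ha0.trans haT.le
  have hX := hY.isBilliardSolution hF hr hu
  have hmem : ∀ s : ℝ, -r < (-1) ^ i * s → (-1) ^ i * s < r → s ∈ Ioo (-r) r := by
    intro s hs1 hs2
    rcases neg_one_zpow_cases i with h | h <;> rw [h] at hs1 hs2 <;> constructor <;> linarith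
  have hxint : ∀ t ∈ Ioc a b, x t ∈ Ioo (-r) r := fun t ht => by
    obtain ⟨g1, g2, -⟩ := hb ht
    exact hmem _ (by linarith) g2
  have hXint : ∀ t ∈ Ioc a b, tent r (Y t) ∈ Ioo (-r) r := fun t ht => by
    obtain ⟨-, -, g3, -⟩ := hb ht
    have g4 := hmono ht.1
    refine hmem _ ?_ ?_ <;>
      rw [tent_of_mem_cell hr i (h1.trans g4.le) g3.le, ← mul_assoc, hsq, one_mul] <;> linarith
  have e1 := hx.1.eq_integral hF hT ha0 hab hbT hxint hxq
  have e2 := hX.eq_integral hF hT ha0 hab hbT hXint hXq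
  exact ⟨b, hab, hF.eqOn_of_eq_integral hT hx.1.continuousOn hX.continuousOn ha0 hab.le hbT hbs
    e1 (hxa ▸ e2)⟩

/-- Uniqueness for the impulsive Cauchy problem with large initial velocity. -/
lemma eqOn_tent (hF : IsForcing T F m α) (hr : 0 < r) (hu : ∫ s, m s < u)
    (hx : IsCauchySolution r T F u x) (hY : IsUnfolded r F u 0 Y p) :
    EqOn x (fun t => tent r (Y t)) (Icc 0 T) := by
  set X : ℝ → ℝ := fun t => tent r (Y t) with hX
  have hXc : Continuous X := (continuous_tent r).comp hY.continuous
  by_contra hne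
  rw [EqOn] at hne
  push Not at hne
  obtain ⟨t₁, ht₁, hne⟩ := hne
  set B := {t | t ∈ Icc 0 T ∧ x t ≠ X t} with hB
  have hbdd : BddBelow B := ⟨0, fun t ht => ht.1.1⟩
  have hBne : B.Nonempty := ⟨t₁, ht₁, hne⟩
  -- At the infimum of the disagreement times the motions still agree by continuity, and the local
  -- extension past `a` gives a contradiction.
  set a := sInf B with ha
  have ha0 : 0 ≤ a := le_csInf hBne fun t ht => ht.1.1
  have hat₁ : a ≤ t₁ := csInf_le hbdd ⟨ht₁, hne⟩
  have hlt : EqOn x X (Ico 0 a) := by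
    intro t ht
    by_contra h
    exact (notMem_of_lt_csInf ht.2 hbdd) ⟨⟨ht.1, ht.2.le.trans (hat₁.trans ht₁.2)⟩, h⟩
  have heq : EqOn x X (Icc 0 a) := by
    rcases ha0.eq_or_lt with h0 | hpos
    · intro t ht
      rw [← h0, Icc_self, mem_singleton_iff] at ht
      simp only [ht, hX, hx.2.1, hY.pos_zero, tent_zero]
    · exact hlt.of_subset_closure
        (hx.1.continuousOn.mono (Icc_subset_Icc_right (hat₁.trans ht₁.2))) hXc.continuousOn
        Ico_subset_Icc_self (by rw [closure_Ico hpos.ne])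
  have hlt₁ : a < t₁ := lt_of_le_of_ne hat₁ fun h => hne (h ▸ heq ⟨ha0, le_rfl⟩)
  obtain ⟨b, hab, hb⟩ := hY.exists_eqOn_of_eqOn hF hr hu hx ha0 (hlt₁.trans_le ht₁.2) heq
  obtain ⟨c, hc, hcb⟩ := exists_lt_of_csInf_lt hBne hab
  exact hc.2 (hb ⟨csInf_le hbdd hc, hcb.le⟩)

end IsUnfolded

/-! ### Impact count and final position. -/

/-- The set is an initial segment of `ℕ`: having `n` elements, it contains `n - 1` (if `n > 0`) and
omits `n`. -/
lemma bounds_of_encard_odd_multiples {r y : ℝ} (hr : 0 < r) (hy : 0 ≤ y) {n : ℕ}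
    (h : {i : ℕ | (2 * i + 1) * r ≤ y}.encard = n) :
    (2 * n - 1) * r ≤ y ∧ y < (2 * n + 1) * r := by
  constructor
  · rcases n with _ | k
    · push_cast; linarith
    · by_contra! hlt
      have hsub : {i : ℕ | (2 * i + 1) * r ≤ y} ⊆ ↑(Finset.range k) := by
        intro i (hi : (2 * i + 1) * r ≤ y)
        have h1 := lt_of_mul_lt_mul_right (hi.trans_lt hlt) hr.le
        push_cast at h1
        have h2 : (i : ℝ) < k := by linarith
        simpa using h2
      have h1 := encard_le_encard hsub
      rw [h, encard_coe_eq_coe_finsetCard, Finset.card_range] at h1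
      have h2 : k + 1 ≤ k := by exact_mod_cast h1
      omega
  · by_contra! hle
    have hsub : (↑(Finset.range (n + 1)) : Set ℕ) ⊆ {i : ℕ | (2 * i + 1) * r ≤ y} := by
      intro i hi
      have h1 : i ≤ n := by simpa [Nat.lt_succ_iff] using hi
      have h2 : (i : ℝ) ≤ n := by exact_mod_cast h1
      exact (mul_le_mul_of_nonneg_right (by linarith) hr.le).trans hle
    have h1 := encard_le_encard hsub
    rw [h, encard_coe_eq_coe_finsetCard, Finset.card_range] at h1
    have h2 : n + 1 ≤ n := by exact_mod_cast h1
    omega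

namespace IsUnfolded

variable {T r u : ℝ} {F : ℝ → ℝ → ℝ} {m α x Y p : ℝ → ℝ}

/-- The impacts correspond to the cell walls passed by the unfolded motion. -/
lemma encard_impactTimes (hr : 0 < r) (hT : 0 ≤ T) (hY : IsUnfolded r F u 0 Y p)
    (hmono : StrictMono Y) (heq : EqOn x (fun t => tent r (Y t)) (Icc 0 T)) :
    (impactTimes r T x).encard = {i : ℕ | (2 * i + 1) * r ≤ Y T}.encard := by
  have hinj : Function.Injective fun i : ℕ => (2 * (i : ℝ) + 1) * r := by
    intro i j hij
    have h1 := mul_right_cancel₀ hr.ne' hij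
    have h2 : (i : ℝ) = j := by linarith
    exact_mod_cast h2
  -- Impact times and indices are both mapped injectively to wall positions, where the two sets
  -- coincide.
  rw [← hmono.injective.encard_image, ← hinj.encard_image]
  congr 1
  ext y
  constructor
  · rintro ⟨t, ⟨ht, hw⟩, rfl⟩
    rw [heq ht] at hw
    obtain ⟨i, hi⟩ := (tent_eq_wall_iff hr (Y t)).1 hw
    have h0 : 0 ≤ Y t := hY.pos_zero ▸ hmono.monotone ht.1
    have hi0 : (0 : ℝ) < i := by
      by_contra! hle
      nlinarith
    have hi0 : 0 < i := by exact_mod_cast hi0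
    obtain ⟨k, rfl⟩ : ∃ k : ℕ, i = k + 1 := ⟨(i - 1).toNat, by omega⟩
    have hk : (2 * (k : ℝ) + 1) * r = Y t := by rw [hi]; push_cast; ring
    exact ⟨k, hk.le.trans (hmono.monotone ht.2), hk⟩
  · rintro ⟨i, hi, rfl⟩
    obtain ⟨t, ht, hti⟩ := intermediate_value_Icc hT hY.continuous.continuousOn
      (show (2 * (i : ℝ) + 1) * r ∈ Icc (Y 0) (Y T) from ⟨by rw [hY.pos_zero]; positivity, hi⟩)
    refine ⟨t, ⟨ht, ?_⟩, hti⟩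
    rw [heq ht]
    exact (tent_eq_wall_iff hr (Y t)).2 ⟨i + 1, by rw [hti]; push_cast; ring⟩

lemma bounds_of_encard_impactTimes (hr : 0 < r) (hT : 0 ≤ T) (hY : IsUnfolded r F u 0 Y p)
    (hmono : StrictMono Y) (heq : EqOn x (fun t => tent r (Y t)) (Icc 0 T)) {n : ℕ}
    (hn : (impactTimes r T x).encard = n) :
    (2 * n - 1) * r ≤ Y T ∧ Y T < (2 * n + 1) * r :=
  bounds_of_encard_odd_multiples hr (hY.pos_zero ▸ hmono.monotone hT)
    (hY.encard_impactTimes hr hT hmono heq ▸ hn)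

lemma isCauchySolution (hF : IsForcing T F m α) (hr : 0 < r) (hu : ∫ s, m s < u)
    (hY : IsUnfolded r F u 0 Y p) : IsCauchySolution r T F u fun t => tent r (Y t) := by
  refine ⟨hY.isBilliardSolution hF hr hu, by simp only [hY.pos_zero, tent_zero], ?_⟩
  have := hY.hasDerivWithinAt_tent_right hr (hY.strictMono hF hu) (t := 0) (i := 0)
    (by rw [hY.pos_zero]; simp [hr.le]) (by rw [hY.pos_zero]; simp [hr])
  rwa [zpow_zero, one_mul, hY.vel_zero] at this

/-- The final position of the unfolded motion is determined by its initial velocity. -/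
lemma final_pos_unique {X q : ℝ → ℝ} (hF : IsForcing T F m α) (hr : 0 < r) (hT : 0 ≤ T)
    (hu : ∫ s, m s < u) (hY : IsUnfolded r F u 0 Y p) (hX : IsUnfolded r F u 0 X q) :
    Y T = X T := by
  have hYm := hY.strictMono hF hu
  have hXm := hX.strictMono hF hu
  have heq := hX.eqOn_tent hF hr hu (hY.isCauchySolution hF hr hu)
  -- The folded motions agree, hence have the same number `n` of impacts. So both final positions
  -- lie in cell `n`, on which folding is injective.
  obtain ⟨n, hn⟩ : ∃ n : ℕ, (impactTimes r T fun t => tent r (Y t)).encard = n := by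
    rw [hY.encard_impactTimes hr hT hYm fun _ _ => rfl]
    refine (Set.Finite.exists_encard_eq_coe ?_)
    obtain ⟨N, hN⟩ := exists_nat_ge (Y T / r)
    rw [div_le_iff₀ hr] at hN
    refine (finite_Iic N).subset fun i (hi : (2 * (i : ℝ) + 1) * r ≤ Y T) => ?_
    have h1 : 2 * (i : ℝ) + 1 ≤ N := le_of_mul_le_mul_right (hi.trans hN) hr
    have h2 : (i : ℝ) ≤ N := by linarith [Nat.cast_nonneg (α := ℝ) i]
    exact_mod_cast h2
  obtain ⟨a1, a2⟩ := hY.bounds_of_encard_impactTimes hr hT hYm (fun _ _ => rfl) hn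
  obtain ⟨b1, b2⟩ := hX.bounds_of_encard_impactTimes hr hT hXm heq hn
  have hTeq : tent r (Y T) = tent r (X T) := heq (x := T) ⟨hT, le_rfl⟩
  rw [tent_of_mem_cell hr n (by push_cast; linarith) (by push_cast; linarith),
    tent_of_mem_cell hr n (by push_cast; linarith) (by push_cast; linarith)] at hTeq
  have := mul_left_cancel₀ (zpow_ne_zero _ (by norm_num)) hTeq
  linarith

end IsUnfolded

/-! ### Continuous dependence and intermediate values. -/

/-- Intermediate final positions of unfolded motions are attained. -/
lemma IsForcing.exists_final_pos_eq {T r v w d : ℝ} {F : ℝ → ℝ → ℝ} {m α Yv pv Yw pw : ℝ → ℝ}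
    (hF : IsForcing T F m α) (hr : 0 < r) (hT : 0 ≤ T) (hv : ∫ s, m s < v) (hw : ∫ s, m s < w)
    (hYv : IsUnfolded r F v 0 Yv pv) (hYw : IsUnfolded r F w 0 Yw pw) (hd : d ∈ Icc (Yv T) (Yw T)) :
    ∃ u, ∫ s, m s < u ∧ ∃ Y p, IsUnfolded r F u 0 Y p ∧ Y T = d := by
  choose! Y p hY using fun (u : ℝ) (hu : ∫ s, m s < u) => hF.exists_isUnfolded hr hT hu
  have hcont : ContinuousOn (fun u => Y u T) (Ioi (∫ s, m s)) := by
    intro u hu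
    refine ContinuousAt.continuousWithinAt ?_
    rw [ContinuousAt, tendsto_iff_seq_tendsto]
    intro us hus
    -- Every subsequence has a further one along which the motions converge to some motion with
    -- velocity `u`; whichever it is, its final position is the same.
    refine tendsto_of_subseq_tendsto fun ns hns => ?_
    have hlim := hus.comp hns
    -- The shift by `N` discards the velocities not above `∫ m`, for which `Y` is unspecified.
    obtain ⟨N, hN⟩ := eventually_atTop.1 (hlim.eventually (Ioi_mem_nhds hu))
    have hlim' := hlim.comp (tendsto_add_atTop_nat N)
    obtain ⟨φ, -, X, q, hX, hφ⟩ := hF.exists_subseq_tendsto hr hT hu hlim' tendsto_const_nhds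
      fun n => hY _ (hN (n + N) (by omega))
    refine ⟨fun n => φ n + N, ?_⟩
    rw [(hY u hu).final_pos_unique hF hr hT hu hX]
    exact hφ T ⟨hT, le_rfl⟩
  obtain ⟨u, hu, hud⟩ := isPreconnected_Ioi.intermediate_value hv hw hcont
    (show d ∈ Icc (Y v T) (Y w T) by
      rwa [(hY v hv).final_pos_unique hF hr hT hv hYv, (hY w hw).final_pos_unique hF hr hT hw hYw])
  exact ⟨u, hu, Y u, p u, hY u hu, hud⟩

/-! ### Reduction to extended forces and conclusion. -/

lemma IsBilliardSolution.congr {r T : ℝ} {f g : ℝ → ℝ → ℝ} {x : ℝ → ℝ}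
    (hx : IsBilliardSolution r T f x) (hfg : ∀ t ∈ Icc 0 T, f t = g t) :
    IsBilliardSolution r T g x := by
  refine ⟨hx.continuousOn, hx.mem_table, fun a b ha hab hb hint => ?_, hx.impact⟩
  obtain ⟨u, hu, hxu, hode⟩ := hx.ode a b ha hab hb hint
  refine ⟨u, hu, hxu, ?_⟩
  rw [ae_restrict_iff' measurableSet_Icc] at hode ⊢
  filter_upwards [hode] with t ht hmem
  rw [← hfg t ⟨ha.trans hmem.1, hmem.2.trans hb⟩]
  exact ht hmem

/-- Extension of a Carathéodory function by zero outside of the time interval. -/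
lemma IsCaratheodoryBoundedBy.exists_isForcing {T : ℝ} {f : ℝ → ℝ → ℝ} {m : ℝ → ℝ}
    (hm : IsCaratheodoryBoundedBy T f m) (hl : IsIntegrablyLipschitz T f) :
    ∃ F m' α, IsForcing T F m' α ∧ (∀ t ∈ Icc 0 T, f t = F t) ∧
      ∫ t, m' t = ∫ t in Icc 0 T, |m t| := by
  obtain ⟨α, hα, hlip⟩ := hl
  refine ⟨fun t x => (Icc 0 T).indicator (fun t => f t x) t, (Icc 0 T).indicator fun t => |m t|,
    (Icc 0 T).indicator α, ⟨fun x => ?_, ?_, fun t x => ?_, ?_, ?_, ?_⟩, ?_, ?_⟩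
  · exact (aemeasurable_indicator_iff measurableSet_Icc).2 (hm.measurable x)
  · exact (integrable_indicator_iff measurableSet_Icc).2 hm.integrable.abs
  · by_cases ht : t ∈ Icc 0 T
    · simpa only [indicator_of_mem ht] using (hm.bound t ht x).trans (le_abs_self _)
    · simp only [indicator_of_notMem ht, abs_zero, le_refl]
  · exact (integrable_indicator_iff measurableSet_Icc).2 hα
  · rw [ae_restrict_iff' measurableSet_Icc] at hlip
    filter_upwards [hlip] with t ht x y
    by_cases h : t ∈ Icc 0 T
    · simpa only [indicator_of_mem h] using ht h x y
    · simp [indicator_of_notMem h]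
  · intro t ht x
    exact indicator_of_notMem ht _
  · intro t ht
    ext x
    exact (indicator_of_mem ht (fun t => f t x)).symm
  · exact integral_indicator measurableSet_Icc

theorem mainTheorem1 (r T : ℝ) (hr : 0 < r) (hT : 0 < T)
    (f : ℝ → ℝ → ℝ) (m : ℝ → ℝ)
    (hH1 : IsCaratheodoryBoundedBy T f m) (hH2 : IsIntegrablyLipschitz T f)
    (v w : ℝ) (hv : ∫ t in Set.Icc 0 T, |m t| < v) (hw : ∫ t in Set.Icc 0 T, |m t| < w)
    (xv xw : ℝ → ℝ)
    (hxv : IsCauchySolution r T f v xv) (hxw : IsCauchySolution r T f w xw)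
    (k j : ℕ) (hk : (impactTimes r T xv).encard = (k : ℕ∞))
    (hkj : (impactTimes r T xw).encard = ((k + j : ℕ) : ℕ∞)) (hj : 2 ≤ j) :
    ∃ x : ℝ → ℝ, IsDirichletSolution r T f x := by
  obtain ⟨F, m', α, hF, hfF, hmm⟩ := hH1.exists_isForcing hH2
  rw [← hmm] at hv hw
  have hT' := hT.le
  obtain ⟨Yv, pv, hYv⟩ := hF.exists_isUnfolded hr hT' hv
  obtain ⟨Yw, pw, hYw⟩ := hF.exists_isUnfolded hr hT' hw
  have bv := (hYv.bounds_of_encard_impactTimes hr hT' (hYv.strictMono hF hv)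
    (hYv.eqOn_tent hF hr hv ⟨hxv.1.congr hfF, hxv.2⟩) hk).2
  have bw := (hYw.bounds_of_encard_impactTimes hr hT' (hYw.strictMono hF hw)
    (hYw.eqOn_tent hF hr hw ⟨hxw.1.congr hfF, hxw.2⟩) hkj).1
  have hj' : (2 : ℝ) ≤ j := by exact_mod_cast hj
  -- The centre of the cell between the walls `(2k+1)r` and `(2k+3)r`; `j ≥ 2` is what puts `Yw T`
  -- past the second wall.
  have hd : 2 * r * ((k + 1 : ℕ) : ℤ) ∈ Icc (Yv T) (Yw T) := by
    push_cast at bw ⊢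
    constructor <;> nlinarith
  obtain ⟨u, hu, Y, p, hY, hYT⟩ := hF.exists_final_pos_eq hr hT' hv hw hYv hYw hd
  refine ⟨fun t => tent r (Y t), (hY.isBilliardSolution hF hr hu).congr fun t ht => (hfF t ht).symm,
    by simp only [hY.pos_zero, tent_zero], ?_⟩
  simp only [hYT]
  rw [tent_of_mem_cell hr ((k + 1 : ℕ) : ℤ) (by linarith) (by linarith), sub_self, mul_zero]
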